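/- Let $N\ge 1$, $\kappa>0$ and $\alpha_1,\dots,\alpha_N\in\mathbb R$, and consider the reduced amplitude system $$\dot r_j=(\alpha_j-r_j^2)\,r_j+\frac{\kappa}{N}\sum_{l=1}^N (r_l-r_j),\qquad j=1,\dots,N,$$ on the phase space $\{r\in\mathbb R^N: r_j\ge 0 \text{ for all } j\}$. Suppose that at least one of the following conditions holds: (i) $\sum_{j=1}^N\alpha_j>0$; (ii) $\kappa<\alpha_j$ for some $j$; (iii) $\kappa\neq\alpha_j$ for all $j$ and $\sum_{j=1}^N\frac{\alpha_j}{\kappa-\alpha_j}>0$. Then the amplitude death state $r=0$ is a fixed point which is unstable, i.e. not Lyapunov stable within the phase space. Moreover, there is exactly one active fixed point, that is, a fixed point $r^\infty$ with $r^\infty_j>0$ for all $j$, and it is stable, in the following exponential sense: there are $\delta,C,c>0$ such that every solution $r(t)$ in the phase space with $|r(0)-r^\infty|<\delta$ satisfies $|r(t)-r^\infty|\le C e^{-ct}\,|r(0)-r^\infty|$ for all $t\ge 0$. -/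

import Mathlib

/-- The right-hand side of the reduced amplitude system
`r_j' = (α_j - r_j ^ 2) r_j + (κ / N) ∑ l, (r_l - r_j)`. -/
noncomputable def amplitudeField {N : ℕ} (κ : ℝ) (α : Fin N → ℝ) (r : Fin N → ℝ) : Fin N → ℝ :=
  fun j => (α j - r j ^ 2) * r j + κ / (N : ℝ) * ∑ l, (r l - r j)

/-- `r` solves the reduced amplitude system on the time interval `[0, T]`, with values in the
phase space `{r | r_j ≥ 0 for all j}` (one-sided derivatives at the endpoints). -/
structure IsAmplitudeSolution {N : ℕ} (κ : ℝ) (α : Fin N → ℝ) (T : ℝ) (r : ℝ → Fin N → ℝ) :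
    Prop where
  nonneg : ∀ t ∈ Set.Icc 0 T, ∀ j, 0 ≤ r t j
  hasDeriv : ∀ t ∈ Set.Icc 0 T,
    HasDerivWithinAt r (amplitudeField κ α (r t)) (Set.Icc 0 T) t

/-- `p` is a fixed point (equilibrium) of the reduced amplitude system. -/
def IsAmplitudeFixedPoint {N : ℕ} (κ : ℝ) (α : Fin N → ℝ) (p : Fin N → ℝ) : Prop :=
  amplitudeField κ α p = 0

/-- `p` is an active fixed point: a fixed point all of whose amplitudes are positive. -/
def IsActiveFixedPoint {N : ℕ} (κ : ℝ) (α : Fin N → ℝ) (p : Fin N → ℝ) : Prop :=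
  IsAmplitudeFixedPoint κ α p ∧ ∀ j, 0 < p j

/-- Lyapunov stability of the point `p` in the phase space: every solution that starts close to `p`
stays close to `p` for as long as it is defined. -/
def IsLyapunovStable {N : ℕ} (κ : ℝ) (α : Fin N → ℝ) (p : Fin N → ℝ) : Prop :=
  ∀ ε > 0, ∃ δ > 0, ∀ T > 0, ∀ r : ℝ → Fin N → ℝ, IsAmplitudeSolution κ α T r →
    dist (r 0) p < δ → ∀ t ∈ Set.Icc 0 T, dist (r t) p < ε

/-- Local exponential stability of the point `p`. For a fixed point of a smooth
system this is the same as linear stability (all eigenvalues of the linearization have negative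
real part), and it implies Lyapunov stability and local attraction. -/
def IsExponentiallyStable {N : ℕ} (κ : ℝ) (α : Fin N → ℝ) (p : Fin N → ℝ) : Prop :=
  ∃ δ > 0, ∃ C > 0, ∃ c > 0, ∀ T > 0, ∀ r : ℝ → Fin N → ℝ, IsAmplitudeSolution κ α T r →
    dist (r 0) p < δ → ∀ t ∈ Set.Icc 0 T,
      dist (r t) p ≤ C * Real.exp (-c * t) * dist (r 0) p

/-! The field is cooperative (`amplitudeField_le_of_le`), and along the ray through a fixed point
`p` it is `s (1 - s²) p_j³`, inward beyond `p` and outward before it. Each of (i)–(iii) yields `w >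
0` with `M w > 0`, where `M` is the symmetric linearization at `0`. Pairing solutions with `w` shows
that `0` is unstable; small multiples of `w` are subsolutions, which yields an active fixed point.
Comparison with multiples of `p` gives uniqueness and exponential stability. -/

theorem amplitudeField_apply {N : ℕ} [NeZero N] (κ : ℝ) (α r : Fin N → ℝ) (j : Fin N) :
    amplitudeField κ α r j = (α j - κ - r j ^ 2) * r j + κ / N * ∑ l, r l := by
  have hN : (N : ℝ) ≠ 0 := Nat.cast_ne_zero.mpr (NeZero.ne N)
  simp only [amplitudeField, Finset.sum_sub_distrib, Finset.sum_const, Finset.card_univ,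
    Fintype.card_fin, nsmul_eq_mul]
  field_simp
  ring

theorem contDiff_amplitudeField {N : ℕ} (κ : ℝ) (α : Fin N → ℝ) :
    ContDiff ℝ 1 (amplitudeField κ α) := by
  unfold amplitudeField
  fun_prop

/-- The amplitude system is cooperative. -/
theorem amplitudeField_le_of_le {N : ℕ} [NeZero N] {κ : ℝ} (hκ : 0 < κ) (α : Fin N → ℝ)
    {r u : Fin N → ℝ} (h : ∀ l, r l ≤ u l) {j : Fin N} (hj : r j = u j) :
    amplitudeField κ α r j ≤ amplitudeField κ α u j := by
  rw [amplitudeField_apply, amplitudeField_apply, hj]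
  have := Finset.sum_le_sum fun l (_ : l ∈ Finset.univ) => h l
  gcongr

theorem amplitudeField_const_nonpos {N : ℕ} {κ : ℝ} {α : Fin N → ℝ} {R : ℝ} (hR : 0 ≤ R)
    (hα : ∀ j, α j ≤ R ^ 2) (j : Fin N) : amplitudeField κ α (fun _ => R) j ≤ 0 := by
  simpa [amplitudeField] using mul_nonpos_of_nonpos_of_nonneg (sub_nonpos.mpr (hα j)) hR

/-- At a fixed point the linear part equals `p_j ^ 3`; scaling multiplies it by `s` and the cubic
part by `s ^ 3`. -/
theorem amplitudeField_smul_fixedPoint {N : ℕ} [NeZero N] {κ : ℝ} {α p : Fin N → ℝ}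
    (hp : IsAmplitudeFixedPoint κ α p) (s : ℝ) (j : Fin N) :
    amplitudeField κ α (s • p) j = s * (1 - s ^ 2) * p j ^ 3 := by
  have h := congrFun hp j
  rw [amplitudeField_apply] at h ⊢
  simp only [Pi.smul_apply, smul_eq_mul, Pi.zero_apply, ← Finset.mul_sum] at h ⊢
  linear_combination s * h

theorem exists_pos_forall_le {ι : Type*} [Finite ι] {f : ι → ℝ} (hf : ∀ i, 0 < f i) :
    ∃ m > 0, ∀ i, m ≤ f i := by
  rcases isEmpty_or_nonempty ι with h | h
  · exact ⟨1, one_pos, fun i => h.elim i⟩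
  · obtain ⟨i, hi⟩ := Finite.exists_min f
    exact ⟨f i, hf i, hi⟩

/-! ### Barrier arguments and existence of solutions -/

/-- A finite family of differentiable functions stays nonnegative if, as long as all are
nonnegative, each one that vanishes has positive derivative. -/
theorem nonneg_of_deriv_pos_of_eq_zero {ι : Type*} [Finite ι] {T : ℝ} {y y' : ℝ → ι → ℝ}
    (hy : ∀ t ∈ Set.Icc 0 T, ∀ j, HasDerivWithinAt (fun s => y s j) (y' t j) (Set.Icc 0 T) t)
    (h0 : ∀ j, 0 ≤ y 0 j)
    (hpos : ∀ t ∈ Set.Icc 0 T, (∀ l, 0 ≤ y t l) → ∀ j, y t j = 0 → 0 < y' t j) :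
    ∀ t ∈ Set.Icc 0 T, ∀ j, 0 ≤ y t j := by
  have hcont : ContinuousOn y (Set.Icc 0 T) :=
    continuousOn_pi.mpr fun j t ht => (hy t ht j).continuousWithinAt
  have hclosed : IsClosed ({t | ∀ j, 0 ≤ y t j} ∩ Set.Icc 0 T) := by
    rw [Set.inter_comm]
    exact hcont.preimage_isClosed_of_isClosed isClosed_Icc (isClosed_Ici (a := (0 : ι → ℝ)))
  refine hclosed.Icc_subset_of_forall_mem_nhdsWithin h0 ?_
  rintro t ⟨hnn, ht⟩
  have htI := Set.Ico_subset_Icc_self ht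
  refine Filter.eventually_all.mpr fun j => ?_
  have hd : HasDerivWithinAt (fun s => y s j) (y' t j) (Set.Ioi t) t :=
    ((hy t htI j).mono (Set.Icc_subset_Icc_left ht.1)).mono_of_mem_nhdsWithin
      (Icc_mem_nhdsGT ht.2)
  rcases (hnn j).eq_or_lt with h | h
  · have hs := (hasDerivWithinAt_iff_tendsto_slope' (Set.self_notMem_Ioi)).mp hd
    filter_upwards [hs.eventually_const_lt (hpos t htI hnn j h.symm), self_mem_nhdsWithin]
      with s hs hst
    rw [slope_def_field, ← h, sub_zero] at hs
    exact ((div_pos_iff_of_pos_right (sub_pos.mpr hst)).mp hs).le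
  · filter_upwards [hd.continuousWithinAt.eventually_const_lt h] with s hs using hs.le

/-- A differentiable function whose derivative is nonnegative wherever it is negative
stays nonnegative. -/
theorem nonneg_of_deriv_nonneg_of_neg {T : ℝ} {y y' : ℝ → ℝ}
    (hy : ∀ t ∈ Set.Icc 0 T, HasDerivWithinAt y (y' t) (Set.Icc 0 T) t) (h0 : 0 ≤ y 0)
    (hneg : ∀ t ∈ Set.Icc 0 T, y t < 0 → 0 ≤ y' t) :
    ∀ t ∈ Set.Icc 0 T, 0 ≤ y t := by
  intro t ht
  refine le_of_forall_pos_le_add fun ε hε => ?_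
  -- An increasing perturbation, equal to `ε` at time `t`, makes the derivative condition strict.
  have hη : 0 < ε / (1 + t) := div_pos hε (by linarith [ht.1])
  have key := nonneg_of_deriv_pos_of_eq_zero (ι := Unit) (T := T)
    (y := fun s _ => y s + ε / (1 + t) * (1 + s)) (y' := fun s _ => y' s + ε / (1 + t))
    (fun s hs _ => by
      have h := ((hasDerivWithinAt_id s (Set.Icc 0 T)).const_add 1).const_mul (ε / (1 + t))
      rw [mul_one] at h
      exact (hy s hs).fun_add h)
    (fun _ => by simpa using add_nonneg h0 hη.le)
    (fun s hs _ _ hz => by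
      have h1 : 0 < ε / (1 + t) * (1 + s) := mul_pos hη (by linarith [hs.1])
      have := hneg s hs (by linarith)
      linarith) t ht ()
  have h1 : (1 + t) ≠ 0 := by linarith [ht.1]
  rwa [div_mul_cancel₀ _ h1] at key

/-- Clipping to the box `[0, R]^N` makes the field bounded and Lipschitz, so Picard–Lindelöf reaches
any `T`. The clipped field does not point out of the box, so the solution stays there and clipping
has no effect. -/
theorem exists_isAmplitudeSolution {N : ℕ} [NeZero N] {κ : ℝ} (hκ : 0 < κ) {α : Fin N → ℝ}
    {R : ℝ} (hR : 0 ≤ R) (hα : ∀ j, α j ≤ R ^ 2) {x : Fin N → ℝ}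
    (hx : ∀ j, 0 ≤ x j ∧ x j ≤ R) {T : ℝ} (hT : 0 < T) :
    ∃ r, IsAmplitudeSolution κ α T r ∧ r 0 = x := by
  let box : Set (Fin N → ℝ) := Set.Icc 0 fun _ => R
  let clip : (Fin N → ℝ) → Fin N → ℝ := fun r j => max 0 (min R (r j))
  have hclip : ∀ r, clip r ∈ box := fun r =>
    ⟨fun j => le_max_left _ _, fun j => max_le hR (min_le_left _ _)⟩
  have hlip : LipschitzWith 1 clip := by
    refine LipschitzWith.mk_one fun a b => (dist_pi_le_iff dist_nonneg).mpr fun j => ?_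
    have h := ((LipschitzWith.id.const_min R).const_max 0).dist_le_mul (a j) (b j)
    simp only [NNReal.coe_one, one_mul, id] at h
    exact h.trans (dist_le_pi_dist a b j)
  obtain ⟨K, hK⟩ := (contDiff_amplitudeField κ α).contDiffOn.exists_lipschitzOnWith one_ne_zero
    (convex_Icc _ _) (isCompact_Icc : IsCompact box)
  have hgK : LipschitzWith K (fun r => amplitudeField κ α (clip r)) := by
    have h := lipschitzOnWith_univ.mp
      (hK.comp (hlip.lipschitzOnWith (s := Set.univ)) fun r _ => hclip r)
    rwa [mul_one] at h
  obtain ⟨L, hL⟩ := (isCompact_Icc : IsCompact box).exists_bound_of_continuousOn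
    (contDiff_amplitudeField κ α).continuous.continuousOn
  have hL0 : 0 ≤ L := (norm_nonneg _).trans (hL _ (hclip x))
  have hPL : IsPicardLindelof (fun _ r => amplitudeField κ α (clip r))
      (⟨0, le_rfl, hT.le⟩ : Set.Icc 0 T) x (⟨L * T, by positivity⟩ : NNReal) 0 ⟨L, hL0⟩ K := by
    refine ⟨fun _ _ => hgK.lipschitzOnWith, fun _ _ => continuousOn_const,
      fun _ _ r _ => hL _ (hclip r), ?_⟩
    simp only [sub_zero, sub_self, max_eq_left hT.le, NNReal.coe_zero]
    exact le_rfl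
  obtain ⟨r, hr0, hr⟩ := hPL.exists_eq_forall_mem_Icc_hasDerivWithinAt₀
  have hrj := fun t ht => hasDerivWithinAt_pi.mp (hr t ht)
  have hlow : ∀ j, ∀ t ∈ Set.Icc 0 T, 0 ≤ r t j := fun j =>
    nonneg_of_deriv_nonneg_of_neg (fun t ht => hrj t ht j) (by rw [hr0]; exact (hx j).1)
      fun t _ hneg => by
        have hz : clip (r t) j = 0 := max_eq_left ((min_le_right _ _).trans hneg.le)
        rw [amplitudeField_apply, hz]
        have := Finset.sum_nonneg fun l (_ : l ∈ Finset.univ) => (hclip (r t)).1 l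
        simp only [mul_zero, zero_add]
        positivity
  have hup : ∀ j, ∀ t ∈ Set.Icc 0 T, 0 ≤ R - r t j := fun j =>
    nonneg_of_deriv_nonneg_of_neg (fun t ht => (hrj t ht j).const_sub R)
      (by rw [hr0]; exact sub_nonneg.mpr (hx j).2)
      fun t _ hneg => by
        have hz : clip (r t) j = R := by
          simp only [clip, min_eq_left (sub_neg.mp hneg).le, max_eq_right hR]
        exact neg_nonneg.mpr ((amplitudeField_le_of_le hκ α (hclip (r t)).2 hz).trans
          (amplitudeField_const_nonpos hR hα j))
  refine ⟨r, ⟨fun t ht j => hlow j t ht, fun t ht => ?_⟩, hr0⟩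
  have hz : clip (r t) = r t := funext fun j => by
    simp only [clip, min_eq_right (sub_nonneg.mp (hup j t ht)), max_eq_right (hlow j t ht)]
  simpa only [hz] using hr t ht

/-! ### Instability of the origin -/

/-- Under the instability conditions, the linearization at the origin maps some positive vector
to a positive vector. -/
theorem exists_pos_linearization_pos {N : ℕ} [NeZero N] {κ : ℝ} (hκ : 0 < κ) {α : Fin N → ℝ}
    (h : 0 < ∑ j, α j ∨ (∃ j, κ < α j) ∨
      ((∀ j, κ ≠ α j) ∧ 0 < ∑ j, α j / (κ - α j))) :
    ∃ w : Fin N → ℝ, (∀ j, 0 < w j) ∧ ∀ j, 0 < (α j - κ) * w j + κ / N * ∑ l, w l := by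
  have hN : (0 : ℝ) < N := Nat.cast_pos.mpr (NeZero.pos N)
  by_cases hα : ∀ j, α j < κ
  · have hpos : ∀ j, 0 < κ - α j := fun j => sub_pos.mpr (hα j)
    have hsum : 0 < ∑ j, α j / (κ - α j) := by
      rcases h with h | ⟨j, hj⟩ | h
      · have : ∑ j, α j / κ ≤ ∑ j, α j / (κ - α j) := Finset.sum_le_sum fun j _ => by
          rw [div_le_div_iff₀ hκ (hpos j)]
          nlinarith [sq_nonneg (α j)]
        rw [← Finset.sum_div] at this
        exact (div_pos h hκ).trans_le this
      · exact absurd hj (hα j).not_gt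
      · exact h.2
    -- For this `w`, every entry of `M w` equals `(1 / N) ∑ α_j / (κ - α_j)`.
    refine ⟨fun j => 1 / (κ - α j), fun j => one_div_pos.mpr (hpos j), fun j => ?_⟩
    have h1 : ∑ j, α j / (κ - α j) = κ * ∑ j, 1 / (κ - α j) - N := by
      rw [Finset.mul_sum, eq_sub_iff_add_eq]
      have : (N : ℝ) = ∑ _j : Fin N, (1 : ℝ) := by simp
      rw [this, ← Finset.sum_add_distrib]
      refine Finset.sum_congr rfl fun j _ => ?_
      have := (hpos j).ne'
      field_simp
      ring
    rw [h1] at hsum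
    have h2 : (α j - κ) * (1 / (κ - α j)) = -1 := by
      have := (hpos j).ne'
      field_simp
      ring
    have h3 : 1 < κ / N * ∑ j, 1 / (κ - α j) := by
      rw [div_mul_eq_mul_div, one_lt_div hN]
      linarith
    rw [h2]
    linarith
  · obtain ⟨i, hi⟩ := Finite.exists_max α
    have hik : κ ≤ α i := by
      push Not at hα
      obtain ⟨j, hj⟩ := hα
      exact hj.trans (hi j)
    have hd : 0 < κ / N := by positivity
    have hpos : ∀ j, 0 < α i + κ / N - α j := fun j => by linarith [hi j]
    -- The term `l = i` alone makes the coupling at least `1`, while `α i ≥ κ` keeps the diagonal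
    -- part above `-1`.
    refine ⟨fun j => 1 / (α i + κ / N - α j), fun j => one_div_pos.mpr (hpos j), fun j => ?_⟩
    have h1 : 1 / (κ / N) ≤ ∑ l, 1 / (α i + κ / N - α l) := by
      have := Finset.single_le_sum (f := fun l => 1 / (α i + κ / N - α l))
        (fun l _ => (one_div_pos.mpr (hpos l)).le) (Finset.mem_univ i)
      simpa using this
    have h2 : 1 ≤ κ / N * ∑ l, 1 / (α i + κ / N - α l) := by
      rw [div_le_iff₀ hd] at h1
      linarith
    have h3 : -1 < (α j - κ) * (1 / (α i + κ / N - α j)) := by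
      rw [mul_one_div, lt_div_iff₀ (hpos j)]
      linarith
    linarith

/-- Let `V = ∑ w_j r_j`. By symmetry of `M`, `V' ≥ c V` while all `r_j < c`, so `V` grows at least
linearly and eventually contradicts `V < c ∑ w_j`. -/
theorem not_isLyapunovStable_zero {N : ℕ} [NeZero N] {κ : ℝ} (hκ : 0 < κ) {α w : Fin N → ℝ}
    (hw : ∀ j, 0 < w j) (hMw : ∀ j, 0 < (α j - κ) * w j + κ / N * ∑ l, w l) :
    ¬ IsLyapunovStable κ α 0 := by
  intro hst
  obtain ⟨m, hm, hmw⟩ := exists_pos_forall_le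
    (f := fun j => ((α j - κ) * w j + κ / N * ∑ l, w l) / w j) fun j => div_pos (hMw j) (hw j)
  obtain ⟨c, hc, hc2⟩ : ∃ c > 0, c + c ^ 2 ≤ m := by
    refine ⟨min 1 (m / 2), by positivity, ?_⟩
    have h1 : min 1 (m / 2) ≤ 1 := min_le_left _ _
    have h2 : min 1 (m / 2) ≤ m / 2 := min_le_right _ _
    have h3 : 0 < min 1 (m / 2) := by positivity
    nlinarith
  obtain ⟨δ, hδ, hstab⟩ := hst c hc
  obtain ⟨R, hR1, hRα⟩ : ∃ R : ℝ, 1 ≤ R ∧ ∀ j, α j ≤ R ^ 2 := by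
    refine ⟨1 + ‖α‖, by linarith [norm_nonneg α], fun j => ?_⟩
    have := (le_abs_self _).trans (norm_le_pi_norm α j)
    nlinarith [norm_nonneg α]
  obtain ⟨s, hs, hs1, hsδ⟩ : ∃ s > 0, s ≤ 1 ∧ s < δ :=
    ⟨min 1 (δ / 2), by positivity, min_le_left _ _, (min_le_right _ _).trans_lt (by linarith)⟩
  have hW : 0 < ∑ j, w j := Finset.sum_pos (fun j _ => hw j) Finset.univ_nonempty
  have hT : 0 < 1 / s := by positivity
  obtain ⟨T, hT, hTs⟩ : ∃ T > 0, c ≤ s * (c * T) := ⟨1 / s, hT, by field_simp; rfl⟩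
  obtain ⟨r, hr, hr0⟩ := exists_isAmplitudeSolution hκ (by linarith) hRα
    (x := fun _ => s) (fun _ => ⟨hs.le, hs1.trans hR1⟩) hT
  have hsmall := hstab T hT r hr (by
    rw [hr0, dist_pi_lt_iff hδ]
    intro j
    simpa [abs_of_pos hs] using hsδ)
  have hrc : ∀ t ∈ Set.Icc 0 T, ∀ j, r t j < c := fun t ht j => by
    have := (dist_le_pi_dist (r t) 0 j).trans_lt (hsmall t ht)
    rw [Pi.zero_apply, dist_zero_right] at this
    exact (le_abs_self _).trans_lt this
  have hrj := fun t ht => hasDerivWithinAt_pi.mp (hr.hasDeriv t ht)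
  have hy : ∀ t ∈ Set.Icc 0 T, HasDerivWithinAt (fun t => ∑ j, w j * r t j)
      (∑ j, w j * amplitudeField κ α (r t) j) (Set.Icc 0 T) t := fun t ht =>
    HasDerivWithinAt.fun_sum fun j _ => (hrj t ht j).const_mul (w j)
  have hgrow : ∀ t ∈ Set.Icc 0 T,
      c * ∑ j, w j * r t j ≤ ∑ j, w j * amplitudeField κ α (r t) j := by
    intro t ht
    have hsym : ∑ j, w j * amplitudeField κ α (r t) j
        = ∑ j, ((α j - κ) * w j + κ / N * ∑ l, w l - w j * r t j ^ 2) * r t j := by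
      simp only [amplitudeField_apply, mul_add, add_mul, sub_mul, Finset.sum_add_distrib,
        Finset.sum_sub_distrib, mul_sub, ← Finset.sum_mul, ← Finset.mul_sum]
      have e1 : ∑ j, w j * (α j * r t j) = ∑ j, α j * w j * r t j :=
        Finset.sum_congr rfl fun j _ => by ring
      have e2 : ∑ j, w j * (κ * r t j) = ∑ j, κ * w j * r t j :=
        Finset.sum_congr rfl fun j _ => by ring
      have e3 : ∑ j, w j * (r t j ^ 2 * r t j) = ∑ j, w j * r t j ^ 2 * r t j :=
        Finset.sum_congr rfl fun j _ => by ring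
      rw [e1, e2, e3]
      ring
    rw [hsym, Finset.mul_sum]
    refine Finset.sum_le_sum fun j _ => ?_
    rw [← mul_assoc]
    refine mul_le_mul_of_nonneg_right ?_ (hr.nonneg t ht j)
    have h1 := (le_div_iff₀ (hw j)).mp (hmw j)
    have h2 : r t j ^ 2 ≤ c ^ 2 := pow_le_pow_left₀ (hr.nonneg t ht j) (hrc t ht j).le 2
    nlinarith [hw j]
  have hynn : ∀ t ∈ Set.Icc 0 T, s * ∑ j, w j ≤ ∑ j, w j * r t j := by
    intro t ht
    have := nonneg_of_deriv_nonneg_of_neg (T := T)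
      (y := fun t => ∑ j, w j * r t j - s * ∑ j, w j) (fun t ht => (hy t ht).sub_const _)
      (by simp [hr0, Finset.mul_sum, mul_comm]) (fun t ht _ => by
        refine le_trans ?_ (hgrow t ht)
        exact mul_nonneg hc.le
          (Finset.sum_nonneg fun j _ => mul_nonneg (hw j).le (hr.nonneg t ht j))) t ht
    linarith
  have hfin := nonneg_of_deriv_nonneg_of_neg (T := T)
    (y := fun t => ∑ j, w j * r t j - c * (s * ∑ j, w j) * t)
    (fun t ht => (hy t ht).sub ((hasDerivWithinAt_id t _).const_mul (c * (s * ∑ j, w j))))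
    (by
      have := hynn 0 ⟨le_rfl, hT.le⟩
      have h2 : 0 < s * ∑ j, w j := by positivity
      simp only [mul_zero, sub_zero]
      linarith) (fun t ht _ => by
      have h1 := hgrow t ht
      have h2 := mul_le_mul_of_nonneg_left (hynn t ht) hc.le
      linarith) T ⟨hT.le, le_rfl⟩
  have hlt : ∑ j, w j * r T j < ∑ j, w j * c :=
    Finset.sum_lt_sum_of_nonempty Finset.univ_nonempty fun j _ =>
      mul_lt_mul_of_pos_left (hrc T ⟨hT.le, le_rfl⟩ j) (hw j)
  rw [← Finset.sum_mul] at hlt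
  nlinarith

/-! ### The active fixed point -/

theorem exists_isActiveFixedPoint {N : ℕ} [NeZero N] {κ : ℝ} (hκ : 0 < κ) {α w : Fin N → ℝ}
    (hw : ∀ j, 0 < w j) (hMw : ∀ j, 0 < (α j - κ) * w j + κ / N * ∑ l, w l) :
    ∃ p, IsActiveFixedPoint κ α p := by
  obtain ⟨m, hm, hmw⟩ := exists_pos_forall_le
    (f := fun j => ((α j - κ) * w j + κ / N * ∑ l, w l) / w j ^ 3)
    fun j => div_pos (hMw j) (pow_pos (hw j) 3)
  obtain ⟨s, hs, hsm⟩ : ∃ s > 0, s ^ 2 ≤ m := ⟨√m, by positivity, (Real.sq_sqrt hm.le).le⟩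
  have hsub : ∀ j, 0 ≤ amplitudeField κ α (s • w) j := fun j => by
    have h1 := (le_div_iff₀ (pow_pos (hw j) 3)).mp (hmw j)
    have h2 := mul_le_mul_of_nonneg_right hsm (pow_pos (hw j) 3).le
    rw [amplitudeField_apply]
    simp only [Pi.smul_apply, smul_eq_mul, ← Finset.mul_sum]
    have := mul_nonneg hs.le (sub_nonneg.mpr (h2.trans h1))
    linarith
  obtain ⟨R, hR0, hRα, hRw⟩ : ∃ R : ℝ, 0 ≤ R ∧ (∀ j, α j ≤ R ^ 2) ∧ ∀ j, s * w j ≤ R := by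
    refine ⟨1 + ‖α‖ + ‖s • w‖, by positivity, fun j => ?_, fun j => ?_⟩
    · have := (le_abs_self _).trans (norm_le_pi_norm α j)
      nlinarith [norm_nonneg α, norm_nonneg (s • w)]
    · have := (le_abs_self _).trans (norm_le_pi_norm (s • w) j)
      rw [Pi.smul_apply, smul_eq_mul] at this
      linarith [norm_nonneg α]
  have hcont := (contDiff_amplitudeField κ α).continuous
  have hcompact : IsCompact (Set.Icc (s • w) (fun _ => R) ∩ {r | 0 ≤ amplitudeField κ α r}) :=
    isCompact_Icc.inter_right (isClosed_le continuous_const hcont)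
  -- A subsolution of maximal coordinate sum is a fixed point: if component `j` of the field were
  -- positive, raising `p j` slightly would, by cooperativity, give a larger subsolution.
  obtain ⟨p, ⟨⟨hpl, hpu⟩, hpf⟩, hmax⟩ := hcompact.exists_isMaxOn
    ⟨s • w, ⟨le_rfl, hRw⟩, hsub⟩
    (f := fun r : Fin N → ℝ => ∑ l, r l) (by fun_prop)
  refine ⟨p, ?_, fun j => (mul_pos hs (hw j)).trans_le (hpl j)⟩
  by_contra hne
  obtain ⟨j, hj⟩ : ∃ j, 0 < amplitudeField κ α p j := by
    by_contra! hle
    exact hne (le_antisymm hle hpf)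
  have hjR : p j < R := by
    refine lt_of_le_of_ne (hpu j) fun he => hj.not_ge ?_
    exact (amplitudeField_le_of_le hκ α hpu he).trans (amplitudeField_const_nonpos hR0 hRα j)
  have hev : ∀ᶠ x in nhdsWithin (p j) (Set.Ioi (p j)),
      0 < amplitudeField κ α (Function.update p j x) j := by
    have hc : Continuous fun x => amplitudeField κ α (Function.update p j x) j :=
      (continuous_apply j).comp (hcont.comp (continuous_const.update j continuous_id))
    exact (hc.continuousWithinAt (s := Set.Ioi (p j))).eventually_const_lt (by simpa using hj)
  obtain ⟨x, hxf, hx1, hx2⟩ := (hev.and (Ioo_mem_nhdsGT hjR)).exists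
  have hle : p ≤ Function.update p j x := le_update_self_iff.mpr hx1.le
  have hmem : Function.update p j x ∈
      Set.Icc (s • w) (fun _ => R) ∩ {r | 0 ≤ amplitudeField κ α r} := by
    refine ⟨⟨hpl.trans hle, update_le_iff.mpr ⟨hx2.le, fun l _ => hpu l⟩⟩, fun l => ?_⟩
    rcases eq_or_ne l j with rfl | hl
    · exact hxf.le
    · exact (hpf l).trans
        (amplitudeField_le_of_le hκ α hle (Function.update_of_ne hl x p).symm)
  have hlt : ∑ l, p l < ∑ l, Function.update p j x l :=
    Finset.sum_lt_sum (fun l _ => hle l) ⟨j, Finset.mem_univ j, by simpa using hx1⟩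
  exact (hmax hmem).not_gt hlt

/-- With `s = min q_j / p_j`, the point `s • p` touches `q` from below, so cooperativity gives `s (1
- s²) ≤ 0`, that is, `s ≥ 1`. -/
theorem IsActiveFixedPoint.le {N : ℕ} [NeZero N] {κ : ℝ} (hκ : 0 < κ) {α p q : Fin N → ℝ}
    (hp : IsActiveFixedPoint κ α p) (hq : IsActiveFixedPoint κ α q) : p ≤ q := by
  obtain ⟨j, hj⟩ := Finite.exists_min fun j => q j / p j
  have hs : 0 < q j / p j := div_pos (hq.2 j) (hp.2 j)
  have h1 : ∀ l, ((q j / p j) • p) l ≤ q l := fun l => (le_div_iff₀ (hp.2 l)).mp (hj l)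
  have h2 := amplitudeField_le_of_le hκ α h1 (j := j) (div_mul_cancel₀ _ (hp.2 j).ne')
  rw [amplitudeField_smul_fixedPoint hp.1, congrFun hq.1 j, Pi.zero_apply] at h2
  have h3 : 1 ≤ q j / p j := by
    by_contra! hlt
    have : 0 < 1 - (q j / p j) ^ 2 := by nlinarith
    have := hp.2 j
    exact h2.not_gt (by positivity)
  exact fun l => (le_mul_of_one_le_left (hp.2 l).le h3).trans (h1 l)

/-- Near an active fixed point `p`, solutions stay between exponentially contracting multiples
of `p`. -/
theorem IsActiveFixedPoint.abs_sub_le {N : ℕ} [NeZero N] {κ : ℝ} (hκ : 0 < κ) {α p : Fin N → ℝ}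
    (hp : IsActiveFixedPoint κ α p) {c : ℝ} (hc : ∀ j, 2 * c ≤ p j ^ 2) (hc0 : 0 < c) {a : ℝ}
    (ha : 0 < a) (ha2 : a ≤ 1 / 2) {T : ℝ} {r : ℝ → Fin N → ℝ}
    (hr : IsAmplitudeSolution κ α T r) (h0 : ∀ j, |r 0 j - p j| ≤ a * p j) :
    ∀ t ∈ Set.Icc 0 T, ∀ j, |r t j - p j| ≤ a * Real.exp (-c * t) * p j := by
  have hrj := fun t ht => hasDerivWithinAt_pi.mp (hr.hasDeriv t ht)
  have hexp : ∀ t, ∀ j, HasDerivWithinAt (fun t => a * Real.exp (-c * t) * p j)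
      (-c * (a * Real.exp (-c * t)) * p j) (Set.Icc 0 T) t := fun t j => by
    have h := (((hasDerivAt_id t).const_mul (-c)).exp.const_mul a).mul_const (p j)
    exact (h.congr_deriv (by simp only [id]; ring)).hasDerivWithinAt
  have hη : ∀ t ∈ Set.Icc 0 T, 0 < a * Real.exp (-c * t) ∧ a * Real.exp (-c * t) ≤ 1 / 2 :=
    fun t ht => ⟨by positivity, by
      have : Real.exp (-c * t) ≤ 1 := Real.exp_le_one_iff.mpr (by nlinarith [ht.1])
      nlinarith⟩
  have hup := nonneg_of_deriv_pos_of_eq_zero (T := T)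
    (y := fun t j => (p j + a * Real.exp (-c * t) * p j) - r t j)
    (y' := fun t j => -c * (a * Real.exp (-c * t)) * p j - amplitudeField κ α (r t) j)
    (fun t ht j => ((hexp t j).const_add (p j)).sub (hrj t ht j))
    (fun j => by
      have := (abs_le.mp (h0 j)).2
      simp only [mul_zero, Real.exp_zero, mul_one]
      linarith)
    (fun t ht hnn j hj => by
      obtain ⟨h1, h2⟩ := hη t ht
      generalize a * Real.exp (-c * t) = η at *
      have h3 := amplitudeField_le_of_le hκ α (r := r t) (u := (1 + η) • p) (j := j)
        (fun l => by
          have := hnn l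
          simp only [Pi.smul_apply, smul_eq_mul]
          linarith)
        (by simp only [Pi.smul_apply, smul_eq_mul]; linarith)
      rw [amplitudeField_smul_fixedPoint hp.1] at h3
      have h4 := hp.2 j
      have h5 : c * (η * p j) < p j ^ 2 * (η * p j) :=
        mul_lt_mul_of_pos_right (by linarith [hc j]) (by positivity)
      have h6 : 0 < η * p j ^ 3 * (1 + 3 * η + η ^ 2) := by positivity
      nlinarith)
  have hlow := nonneg_of_deriv_pos_of_eq_zero (T := T)
    (y := fun t j => r t j - (p j - a * Real.exp (-c * t) * p j))
    (y' := fun t j => amplitudeField κ α (r t) j - (-(-c * (a * Real.exp (-c * t)) * p j)))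
    (fun t ht j => (hrj t ht j).sub ((hexp t j).const_sub (p j)))
    (fun j => by
      have := (abs_le.mp (h0 j)).1
      simp only [mul_zero, Real.exp_zero, mul_one]
      linarith)
    (fun t ht hnn j hj => by
      obtain ⟨h1, h2⟩ := hη t ht
      generalize a * Real.exp (-c * t) = η at *
      have h3 := amplitudeField_le_of_le hκ α (r := (1 - η) • p) (u := r t) (j := j)
        (fun l => by
          have := hnn l
          simp only [Pi.smul_apply, smul_eq_mul]
          linarith)
        (by simp only [Pi.smul_apply, smul_eq_mul]; linarith)
      rw [amplitudeField_smul_fixedPoint hp.1] at h3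
      have h4 := hp.2 j
      have h5 : 2 * c * (η * p j) ≤ p j ^ 2 * (η * p j) :=
        mul_le_mul_of_nonneg_right (hc j) (by positivity)
      have h6 : 0 < η * p j ^ 3 := by positivity
      -- The field at `(1 - η) • p` is `η (1 - η) (2 - η) p_j³`; this bound and `2 c ≤ p_j²` make it
      -- exceed `c η p_j`.
      have h7 : 1 / 2 < (1 - η) * (2 - η) := by nlinarith
      have h8 := mul_lt_mul_of_pos_left h7 h6
      nlinarith)
  intro t ht j
  have h1 := hup t ht j
  have h2 := hlow t ht j
  exact abs_le.mpr ⟨by linarith, by linarith⟩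

theorem IsActiveFixedPoint.isExponentiallyStable {N : ℕ} [NeZero N] {κ : ℝ} (hκ : 0 < κ)
    {α p : Fin N → ℝ} (hp : IsActiveFixedPoint κ α p) : IsExponentiallyStable κ α p := by
  obtain ⟨m, hm, hmp⟩ := exists_pos_forall_le hp.2
  obtain ⟨M, hM, hMp⟩ : ∃ M > 0, ∀ j, p j ≤ M :=
    ⟨1 + ‖p‖, by positivity, fun j => by
      linarith [(le_abs_self _).trans (norm_le_pi_norm p j)]⟩
  have hc : ∀ j, 2 * (m ^ 2 / 2) ≤ p j ^ 2 := fun j => by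
    linarith [pow_le_pow_left₀ hm.le (hmp j) 2]
  refine ⟨m / 2, by positivity, M / m, by positivity, m ^ 2 / 2, by positivity,
    fun T hT r hr hd t ht => ?_⟩
  have key : ∀ a, 0 < a → a ≤ 1 / 2 → dist (r 0) p ≤ a * m →
      dist (r t) p ≤ a * Real.exp (-(m ^ 2 / 2) * t) * M := fun a ha ha2 hda => by
    refine (dist_pi_le_iff (by positivity)).mpr fun j => ?_
    refine (hp.abs_sub_le hκ hc (by positivity) ha ha2 hr (fun l => ?_) t ht j).trans ?_
    · exact (dist_le_pi_dist (r 0) p l).trans (hda.trans (by gcongr; exact hmp l))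
    · gcongr
      exact hMp j
  rcases (dist_nonneg (x := r 0) (y := p)).eq_or_lt with h0 | h0
  · rw [← h0, mul_zero]
    refine le_of_forall_pos_le_add fun ε hε => ?_
    have hexp : Real.exp (-(m ^ 2 / 2) * t) ≤ 1 :=
      Real.exp_le_one_iff.mpr (by nlinarith [ht.1, sq_nonneg m])
    have ha : 0 < min (1 / 2) (ε / M) := by positivity
    refine (key _ ha (min_le_left _ _) (by rw [← h0]; positivity)).trans ?_
    calc _ ≤ min (1 / 2) (ε / M) * 1 * M := by gcongr
      _ ≤ ε / M * 1 * M := by gcongr; exact min_le_right _ _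
      _ = 0 + ε := by field_simp; ring
  · refine (key (dist (r 0) p / m) (by positivity) ?_ (by field_simp; rfl)).trans_eq ?_
    · rw [div_le_iff₀ hm]
      linarith
    · ring

theorem mainTheorem11 (N : ℕ) (κ : ℝ) (hκ : 0 < κ) (α : Fin N → ℝ)
    (h : 0 < ∑ j, α j ∨ (∃ j, κ < α j) ∨
      ((∀ j, κ ≠ α j) ∧ 0 < ∑ j, α j / (κ - α j))) :
    (IsAmplitudeFixedPoint κ α 0 ∧ ¬ IsLyapunovStable κ α 0) ∧
    ∃ p : Fin N → ℝ, IsActiveFixedPoint κ α p ∧ IsExponentiallyStable κ α p ∧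
      ∀ q : Fin N → ℝ, IsActiveFixedPoint κ α q → q = p := by
  -- For `N = 0` all three conditions fail.
  have : NeZero N := ⟨by rintro rfl; simp at h⟩
  obtain ⟨w, hw, hMw⟩ := exists_pos_linearization_pos hκ h
  obtain ⟨p, hp⟩ := exists_isActiveFixedPoint hκ hw hMw
  refine ⟨⟨?_, not_isLyapunovStable_zero hκ hw hMw⟩, p, hp, hp.isExponentiallyStable hκ,
    fun q hq => le_antisymm (hq.le hκ hp) (hp.le hκ hq)⟩
  ext j
  simp [amplitudeField]
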